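/- Let $T$ be a full binary tree with $n+1$ leaves ($n\ge 0$), i.e. a rooted plane tree in which every internal vertex has a left and a right child. Draw $T$ with its leaves numbered $0,1,\dots,n$ from left to right and placed at equally spaced points of a horizontal line, every vertex being placed at the apex of the isosceles right triangle over the interval of leaves below it; an edge to a left child is called ascending and an edge to a right child descending (as read from left to right). The empty spots of this drawing are filled with balls, one ball $[a,b]$ for each $1\le a\le b\le n-1$, which has horizontal coordinate $(a+b)/2$ and lies in row $b-a$ above the inner leaves. Let $\mathcal D_T$ (respectively $\mathcal A_T$) be the set of balls lying on, i.e. immediately above, the descending (respectively ascending) edges of $T$. Explicitly, if an internal vertex has the leaves $p,\dots,q$ below it, its left child the leaves $p,\dots,r$ and its right child the leaves $r+1,\dots,q$, then the balls on the descending edge to the right child are the $[a,q]$ with $p<a\le r+1$, and the balls on the ascending edge to the left child are the $[p,b]$ with $r\le b<q$. Let $k$ be a field, and let $A_{n-1}$ be the abelian category of finite dimensional representations over $k$ of the quiver $1\leftarrow 2\leftarrow\cdots\leftarrow n-1$ (the zero category if $n\le 1$). The ball $[a,b]$ stands for the indecomposable interval representation $M_{[a,b]}$, which is $k$ at the vertices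 $a,\dots,b$ and $0$ elsewhere, with identity maps between the non-zero spaces. Then $(\mathcal D_T,\mathcal A_T)$ is a torsion pair. That is, with balls as objects: 1. a ball $X$ is in $\mathcal D_T$ if and only if $\mathrm{Hom}(M_X,M_Y)=0$ for all $Y\in\mathcal A_T$; 2. a ball $Y$ is in $\mathcal A_T$ if and only if $\mathrm{Hom}(M_X,M_Y)=0$ for all $X\in\mathcal D_T$. Moreover, in the whole abelian category, let $\mathcal G$ and $\mathcal F$ be the full subcategories of $A_{n-1}$ whose objects are those isomorphic to finite (possibly empty) direct sums of representations $M_X$ with $X\in\mathcal D_T$, respectively $X\in\mathcal A_T$. Then $\mathcal G$ consists of exactly the objects $X$ of $A_{n-1}$ with $\mathrm{Hom}(X,Y)=0$ for all $Y\in\mathcal F$, and $\mathcal F$ consists of exactly the objects $Y$ with $\mathrm{Hom}(X,Y)=0$ for all $X\in\mathcal G$. -/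

import Mathlib

open CategoryTheory CategoryTheory.Limits

universe u

/-! ### The ball structure and binary trees drawn in it -/

/-- The balls in the empty spots of a binary tree with `n + 1` leaves, the leaves being numbered
`0, …, n` from left to right and placed at the points `0, …, n` of a horizontal line.  The balls
form a triangle over the inner leaves `1, …, n - 1`; the ball `(lo, hi)` has horizontal coordinate
`(lo + hi) / 2` and sits in row `hi - lo` (the bottom row is row `0`), so that it is the top of the
sub-triangle of balls over the inner leaves `lo, …, hi`. -/
@[ext]
structure Ball (n : ℕ) where
  lo : ℕ
  hi : ℕ
  one_le_lo : 1 ≤ lo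
  lo_le_hi : lo ≤ hi
  hi_lt : hi < n

/-- An edge of a drawn binary tree, from its upper end `top` to its lower end `bot`.  The point
`(p, q)` with `p ≤ q` is the apex of the isosceles right triangle whose base is the segment from
leaf `p` to leaf `q`; the leaf `p` itself is the point `(p, p)`.  It is the bottom corner of the
unit diamond around the ball `(p, q)`; the left, right and top corners of that diamond are the
points `(p - 1, q)`, `(p, q + 1)` and `(p - 1, q + 1)`. -/
structure TreeEdge where
  top : ℕ × ℕ
  bot : ℕ × ℕ

/-- The descending edges (from a vertex down to its right child) of a full binary tree whose
leftmost leaf is leaf number `p`.  Every vertex is drawn at the apex `(i, j)` over the leaves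
`i, …, j` below it. -/
def descendingEdges : BinaryTree Unit → ℕ → Set TreeEdge
  | .nil, _ => ∅
  | .node _ L R, p =>
      {⟨(p, p + L.numLeaves + R.numNodes), (p + L.numLeaves, p + L.numLeaves + R.numNodes)⟩} ∪
        descendingEdges L p ∪ descendingEdges R (p + L.numLeaves)

/-- The ascending edges (from a vertex down to its left child; read from left to right they
ascend) of a full binary tree whose leftmost leaf is leaf number `p`. -/
def ascendingEdges : BinaryTree Unit → ℕ → Set TreeEdge
  | .nil, _ => ∅
  | .node _ L R, p =>
      {⟨(p, p + L.numLeaves + R.numNodes), (p, p + L.numNodes)⟩} ∪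
        ascendingEdges L p ∪ ascendingEdges R (p + L.numLeaves)

/-- The ball lies on (immediately above) the descending edge `e`: the lower left side of its
diamond, from `(lo - 1, hi)` to `(lo, hi)`, is a part of `e`. -/
def Ball.OnDescending {n : ℕ} (X : Ball n) (e : TreeEdge) : Prop :=
  X.hi = e.top.2 ∧ e.top.1 < X.lo ∧ X.lo ≤ e.bot.1

/-- The ball lies on (immediately above) the ascending edge `e`: the lower right side of its
diamond, from `(lo, hi)` to `(lo, hi + 1)`, is a part of `e`. -/
def Ball.OnAscending {n : ℕ} (X : Ball n) (e : TreeEdge) : Prop :=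
  X.lo = e.top.1 ∧ e.bot.2 ≤ X.hi ∧ X.hi < e.top.2

/-- The set `𝒟_T` of all balls on the descending edges of `T`. -/
def descendingBalls (n : ℕ) (T : BinaryTree Unit) : Set (Ball n) :=
  {X | ∃ e ∈ descendingEdges T 0, X.OnDescending e}

/-- The set `𝒜_T` of all balls on the ascending edges of `T`. -/
def ascendingBalls (n : ℕ) (T : BinaryTree Unit) : Set (Ball n) :=
  {X | ∃ e ∈ ascendingEdges T 0, X.OnAscending e}

/-! ### The category `A_{n-1}` -/

/-- The vertices `1, …, n - 1` of the quiver `A_{n-1}`. -/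
abbrev QuiverVertex (n : ℕ) : Type := Set.Ioo (0 : ℕ) n

/-- The category of finite dimensional representations over `k` of the quiver
`1 ← 2 ← ⋯ ← n - 1`.  The free category on this quiver has exactly one morphism from `i` to `j`
if `j ≤ i` and none otherwise, so it is the opposite of the ordered set `{1, …, n - 1}`. -/
abbrev QuiverRep (k : Type u) [Field k] (n : ℕ) : Type _ :=
  (QuiverVertex n)ᵒᵖ ⥤ FGModuleCat.{u} k

section IntervalModule

variable (k : Type u) [Field k] {n : ℕ}

open Classical in
/-- The value at the vertex `i` of the interval representation of a ball: `k` if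
`lo ≤ i ≤ hi`, and `0` otherwise. -/
noncomputable def Ball.space (X : Ball n) (i : ℕ) : Submodule k k :=
  if X.lo ≤ i ∧ i ≤ X.hi then ⊤ else ⊥

theorem Ball.space_eq_zero (X : Ball n) {i : ℕ} (h : ¬ (X.lo ≤ i ∧ i ≤ X.hi))
    (v : X.space k i) : (v : k) = 0 := by
  obtain ⟨c, hc⟩ := v
  simpa [Ball.space, h] using hc

open Classical in
/-- The map from the vertex `i` to the vertex `j` in the interval representation of a ball: the
identity of `k` if both vertices lie in `lo, …, hi`, and `0` otherwise. -/
noncomputable def Ball.transition (X : Ball n) (i j : ℕ) : X.space k i →ₗ[k] X.space k j :=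
  LinearMap.codRestrict (X.space k j)
    (if X.lo ≤ j ∧ j ≤ X.hi then (X.space k i).subtype else 0) (by
      intro c
      by_cases h : X.lo ≤ j ∧ j ≤ X.hi
      · simp [Ball.space, h]
      · simp [h])

theorem Ball.transition_apply (X : Ball n) {i j : ℕ} (h : X.lo ≤ j ∧ j ≤ X.hi)
    (v : X.space k i) : (X.transition k i j v : k) = v := by
  simp [Ball.transition, h]

theorem Ball.transition_self (X : Ball n) (i : ℕ) :
    X.transition k i i = LinearMap.id := by
  ext v
  by_cases h : X.lo ≤ i ∧ i ≤ X.hi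
  · simp [X.transition_apply k h]
  · rw [X.space_eq_zero k h, X.space_eq_zero k h]

theorem Ball.transition_comp (X : Ball n) {i j l : ℕ} (hji : j ≤ i) (hlj : l ≤ j) :
    (X.transition k j l).comp (X.transition k i j) = X.transition k i l := by
  ext v
  by_cases hl : X.lo ≤ l ∧ l ≤ X.hi
  · by_cases hi : X.lo ≤ i ∧ i ≤ X.hi
    · have hj : X.lo ≤ j ∧ j ≤ X.hi := ⟨hl.1.trans hlj, hji.trans hi.2⟩
      simp [X.transition_apply k hl, X.transition_apply k hj]
    · have hv : v = 0 := Subtype.ext (X.space_eq_zero k hi v)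
      simp [hv]
  · rw [X.space_eq_zero k hl, X.space_eq_zero k hl]

/-- The object of `A_{n-1}` at the ball `(lo, hi)`: the interval representation which is `k` at
the vertices `lo, …, hi` and `0` elsewhere, with identity maps between the nonzero spaces. -/
noncomputable def Ball.rep (X : Ball n) : QuiverRep k n where
  obj i := FGModuleCat.of k (X.space k (i.unop : ℕ))
  map {i j} _ := FGModuleCat.ofHom (X.transition k (i.unop : ℕ) (j.unop : ℕ))
  map_id i := by
    rw [X.transition_self k]
    rfl
  map_comp {i j l} f g := by
    rw [← X.transition_comp k (leOfHom f.unop) (leOfHom g.unop)]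
    rfl

end IntervalModule

/-! ### Torsion pairs -/

/-- A torsion pair in an abelian category: a pair of full subcategories such that
`X` belongs to `G` iff `Hom(X, Y) = 0` for all `Y` in `F`, and
`Y` belongs to `F` iff `Hom(X, Y) = 0` for all `X` in `G`. -/
def IsTorsionPair {C : Type*} [Category C] [Abelian C] (G F : ObjectProperty C) : Prop :=
  (∀ X : C, G X ↔ ∀ Y : C, F Y → ∀ f : X ⟶ Y, f = 0) ∧
    (∀ Y : C, F Y ↔ ∀ X : C, G X → ∀ f : X ⟶ Y, f = 0)

/-- The same notion for sets of balls, where only balls are considered as objects. -/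
def IsBallTorsionPair (k : Type u) [Field k] {n : ℕ} (G F : Set (Ball n)) : Prop :=
  (∀ X : Ball n, X ∈ G ↔ ∀ Y ∈ F, ∀ f : X.rep k ⟶ Y.rep k, f = 0) ∧
    (∀ Y : Ball n, Y ∈ F ↔ ∀ X ∈ G, ∀ f : X.rep k ⟶ Y.rep k, f = 0)

instance quiverRep_hasFiniteBiproducts (k : Type u) [Field k] (n : ℕ) :
    HasFiniteBiproducts (QuiverRep k n) :=
  Abelian.hasFiniteBiproducts

/-- The full subcategory of `A_{n-1}` spanned by a set of balls: the objects isomorphic to a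
finite direct sum (possibly empty) of objects at balls in `S`. -/
def ballClosure (k : Type u) [Field k] {n : ℕ} (S : Set (Ball n)) :
    ObjectProperty (QuiverRep k n) :=
  fun X => ∃ (r : ℕ) (B : Fin r → Ball n), (∀ i, B i ∈ S) ∧
    Nonempty (X ≅ ⨁ fun i => (B i).rep k)

/-! ### Combinatorics of drawn binary trees -/

/-! A nonzero map `M_X → M_Y` has image the interval `[Y.lo, X.hi]`, an upper part (quotient) of `X`
and a lower part (subobject) of `Y`. So Hom-vanishing between balls is the failure of the
inequalities in `Ball.MapsTo`, and the ball statement becomes combinatorics of trees.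

Orthogonality holds because leaf intervals of vertices do not cross (`not_crossing`). For maximality
in the first place, take the smallest vertex over the leaves `X.hi` and `X.hi + 1`: its left child
has leaves `p, …, X.hi`. Either `p < X.lo`, and the right spine ending at leaf `X.hi` passes below
`X`, or `[p, X.hi]` is an ascending ball to which `X` maps. The other half is the mirror image.

For the abelian category, every representation is a finite sum of interval representations
(`ballClosure_univ`): an interval is split off as a retract, and induction on total dimension
finishes. Orthogonality to a direct sum is tested on its summands, so the ball statement carries
over. -/

theorem descendingEdges_bounds {T : BinaryTree Unit} {p : ℕ} {e : TreeEdge}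
    (he : e ∈ descendingEdges T p) :
    p ≤ e.top.1 ∧ e.top.1 < e.bot.1 ∧ e.bot.1 ≤ e.top.2 ∧ e.top.2 ≤ p + T.numNodes := by
  induction T generalizing p with
  | nil => exact he.elim
  | node _ L R ihL ihR =>
    simp only [BinaryTree.numNodes]
    have := L.numLeaves_eq_numNodes_succ
    rcases he with (he | he) | he
    · subst he
      dsimp only
      omega
    · have := ihL he
      omega
    · have := ihR he
      omega

theorem ascendingEdges_bounds {T : BinaryTree Unit} {p : ℕ} {e : TreeEdge}
    (he : e ∈ ascendingEdges T p) :
    p ≤ e.top.1 ∧ e.top.1 ≤ e.bot.2 ∧ e.bot.2 < e.top.2 ∧ e.top.2 ≤ p + T.numNodes := by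
  induction T generalizing p with
  | nil => exact he.elim
  | node _ L R ihL ihR =>
    simp only [BinaryTree.numNodes]
    have := L.numLeaves_eq_numNodes_succ
    rcases he with (he | he) | he
    · subst he
      dsimp only
      omega
    · have := ihL he
      omega
    · have := ihR he
      omega

/-- The leaf intervals of two vertices of a tree do not cross. -/
theorem not_crossing {T : BinaryTree Unit} {p : ℕ} {d e : TreeEdge}
    (hd : d ∈ descendingEdges T p) (he : e ∈ ascendingEdges T p) (h₁ : d.top.1 < e.top.1)
    (h₂ : e.top.1 ≤ d.top.2) : e.top.2 ≤ d.top.2 := by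
  induction T generalizing p with
  | nil => exact hd.elim
  | node _ L R ihL ihR =>
    have hL := L.numLeaves_eq_numNodes_succ
    have bd := descendingEdges_bounds hd
    have be := ascendingEdges_bounds he
    simp only [BinaryTree.numNodes] at bd be
    -- The root's own interval contains everything; edges in different subtrees, or a root ascending
    -- edge starting at `p`, contradict `h₁` or `h₂`.
    rcases hd with (hd | hd) | hd
    · subst hd
      dsimp only at *
      omega
    · have bd' := descendingEdges_bounds hd
      rcases he with (he | he) | he
      · subst he
        dsimp only at *
        omega
      · exact ihL hd he
      · have be' := ascendingEdges_bounds he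
        omega
    · have bd' := descendingEdges_bounds hd
      rcases he with (he | he) | he
      · subst he
        dsimp only at *
        omega
      · have be' := ascendingEdges_bounds he
        omega
      · exact ihR hd he

/-- The right spine of a tree covers all the positions to the right of its leftmost leaf. -/
theorem exists_descendingEdge_spine {T : BinaryTree Unit} {p a : ℕ} (h₁ : p < a)
    (h₂ : a ≤ p + T.numNodes) :
    ∃ e ∈ descendingEdges T p, e.top.2 = p + T.numNodes ∧ e.top.1 < a ∧ a ≤ e.bot.1 := by
  induction T generalizing p with
  | nil =>
    simp only [BinaryTree.numNodes] at h₂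
    omega
  | node _ L R ihL ihR =>
    have hL := L.numLeaves_eq_numNodes_succ
    simp only [BinaryTree.numNodes] at h₂ ⊢
    by_cases h : a ≤ p + L.numLeaves
    · exact ⟨_, Or.inl (Or.inl rfl), by dsimp only; omega, h₁, h⟩
    · obtain ⟨e, he, h₃, h₄⟩ := ihR (p := p + L.numLeaves) (by omega) (by omega)
      exact ⟨e, Or.inr he, by omega, h₄⟩

/-- The left spine of a tree covers all the positions to the left of its rightmost leaf. -/
theorem exists_ascendingEdge_spine {T : BinaryTree Unit} {p b : ℕ} (h₁ : p ≤ b)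
    (h₂ : b < p + T.numNodes) :
    ∃ e ∈ ascendingEdges T p, e.top.1 = p ∧ e.bot.2 ≤ b ∧ b < e.top.2 := by
  induction T generalizing p with
  | nil =>
    simp only [BinaryTree.numNodes] at h₂
    omega
  | node _ L R ihL ihR =>
    have hL := L.numLeaves_eq_numNodes_succ
    simp only [BinaryTree.numNodes] at h₂ ⊢
    by_cases h : p + L.numNodes ≤ b
    · exact ⟨_, Or.inl (Or.inl rfl), rfl, h, by dsimp only; omega⟩
    · obtain ⟨e, he, h₃⟩ := ihL (p := p) (by omega) (by omega)
      exact ⟨e, Or.inl (Or.inr he), h₃⟩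

/-- The left child of the smallest vertex over the leaves `b` and `b + 1`. -/
theorem exists_ascendingEdge_ending_at {T : BinaryTree Unit} {p b : ℕ} (h₁ : p ≤ b)
    (h₂ : b < p + T.numNodes) :
    ∃ e ∈ ascendingEdges T p, e.bot.2 = b ∧ ∀ a, e.top.1 < a → a ≤ b →
      ∃ d ∈ descendingEdges T p, d.top.2 = b ∧ d.top.1 < a ∧ a ≤ d.bot.1 := by
  induction T generalizing p with
  | nil =>
    simp only [BinaryTree.numNodes] at h₂
    omega
  | node _ L R ihL ihR =>
    have hL := L.numLeaves_eq_numNodes_succ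
    simp only [BinaryTree.numNodes] at h₂
    rcases lt_trichotomy b (p + L.numNodes) with h | h | h
    · obtain ⟨e, he, h₃, h₄⟩ := ihL h₁ h
      refine ⟨e, Or.inl (Or.inr he), h₃, fun a h₅ h₆ => ?_⟩
      obtain ⟨d, hd, h₇⟩ := h₄ a h₅ h₆
      exact ⟨d, Or.inl (Or.inr hd), h₇⟩
    -- Leaf `b` is the last leaf of `L`, so the root is the smallest vertex over `b` and `b + 1`,
    -- and the right spine of `L` ends at `b`.
    · refine ⟨_, Or.inl (Or.inl rfl), h.symm, fun a h₅ h₆ => ?_⟩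
      obtain ⟨d, hd, h₇⟩ := exists_descendingEdge_spine (T := L) h₅ (h ▸ h₆)
      exact ⟨d, Or.inl (Or.inr hd), h ▸ h₇⟩
    · obtain ⟨e, he, h₃, h₄⟩ := ihR (p := p + L.numLeaves) (by omega) (by omega)
      refine ⟨e, Or.inr he, h₃, fun a h₅ h₆ => ?_⟩
      obtain ⟨d, hd, h₇⟩ := h₄ a h₅ h₆
      exact ⟨d, Or.inr hd, h₇⟩

/-- The right child of the smallest vertex over the leaves `c - 1` and `c`. -/
theorem exists_descendingEdge_starting_at {T : BinaryTree Unit} {p c : ℕ} (h₁ : p < c)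
    (h₂ : c ≤ p + T.numNodes) :
    ∃ e ∈ descendingEdges T p, e.bot.1 = c ∧ ∀ b, c ≤ b → b < e.top.2 →
      ∃ d ∈ ascendingEdges T p, d.top.1 = c ∧ d.bot.2 ≤ b ∧ b < d.top.2 := by
  induction T generalizing p with
  | nil =>
    simp only [BinaryTree.numNodes] at h₂
    omega
  | node _ L R ihL ihR =>
    have hL := L.numLeaves_eq_numNodes_succ
    simp only [BinaryTree.numNodes] at h₂
    rcases lt_trichotomy c (p + L.numLeaves) with h | h | h
    · obtain ⟨e, he, h₃, h₄⟩ := ihL h₁ (by omega)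
      refine ⟨e, Or.inl (Or.inr he), h₃, fun a h₅ h₆ => ?_⟩
      obtain ⟨d, hd, h₇⟩ := h₄ a h₅ h₆
      exact ⟨d, Or.inl (Or.inr hd), h₇⟩
    · subst h
      refine ⟨_, Or.inl (Or.inl rfl), rfl, fun b h₅ h₆ => ?_⟩
      obtain ⟨d, hd, h₇⟩ := exists_ascendingEdge_spine (T := R) h₅ h₆
      exact ⟨d, Or.inr hd, h₇⟩
    · obtain ⟨e, he, h₃, h₄⟩ := ihR (p := p + L.numLeaves) (by omega) (by omega)
      refine ⟨e, Or.inr he, h₃, fun a h₅ h₆ => ?_⟩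
      obtain ⟨d, hd, h₇⟩ := h₄ a h₅ h₆
      exact ⟨d, Or.inr hd, h₇⟩

/-- The condition on two balls under which there is a nonzero morphism from the interval
representation of the first one to that of the second one. -/
def Ball.MapsTo {n : ℕ} (X Y : Ball n) : Prop :=
  X.lo ≤ Y.lo ∧ Y.lo ≤ X.hi ∧ X.hi ≤ Y.hi

theorem not_mapsTo_of_mem {n : ℕ} {T : BinaryTree Unit} {X Y : Ball n}
    (hX : X ∈ descendingBalls n T) (hY : Y ∈ ascendingBalls n T) : ¬ X.MapsTo Y := by
  obtain ⟨d, hd, hX₁, hX₂, hX₃⟩ := hX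
  obtain ⟨e, he, hY₁, hY₂, hY₃⟩ := hY
  rintro ⟨h₁, h₂, h₃⟩
  have := not_crossing hd he (by omega) (by omega)
  omega

theorem mem_descendingBalls_iff {n : ℕ} {T : BinaryTree Unit} (hT : T.numLeaves = n + 1)
    (X : Ball n) : X ∈ descendingBalls n T ↔ ∀ Y ∈ ascendingBalls n T, ¬ X.MapsTo Y := by
  refine ⟨fun hX Y hY => not_mapsTo_of_mem hX hY, fun h => ?_⟩
  have hn := T.numLeaves_eq_numNodes_succ
  have h₁ := X.one_le_lo
  have h₂ := X.lo_le_hi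
  have h₃ := X.hi_lt
  obtain ⟨e, he, h₄, h₅⟩ := exists_ascendingEdge_ending_at (T := T) (p := 0) (b := X.hi)
    (by omega) (by omega)
  have be := ascendingEdges_bounds he
  by_cases h₆ : e.top.1 < X.lo
  · obtain ⟨d, hd, h₇, h₈⟩ := h₅ _ h₆ h₂
    exact ⟨d, hd, h₇.symm, h₈⟩
  -- Since `X.lo ≤ e.top.1`, the quotient `[e.top.1, X.hi]` of `X` is a genuine ball, the lowest one
  -- on the edge `e`.
  · exact (h ⟨e.top.1, X.hi, by omega, by omega, h₃⟩
      ⟨e, he, rfl, h₄.le, by dsimp only; omega⟩ ⟨by dsimp only; omega,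
        by dsimp only; omega, le_rfl⟩).elim

theorem mem_ascendingBalls_iff {n : ℕ} {T : BinaryTree Unit} (hT : T.numLeaves = n + 1)
    (Y : Ball n) : Y ∈ ascendingBalls n T ↔ ∀ X ∈ descendingBalls n T, ¬ X.MapsTo Y := by
  refine ⟨fun hY X hX => not_mapsTo_of_mem hX hY, fun h => ?_⟩
  have hn := T.numLeaves_eq_numNodes_succ
  have h₁ := Y.one_le_lo
  have h₂ := Y.lo_le_hi
  have h₃ := Y.hi_lt
  obtain ⟨e, he, h₄, h₅⟩ := exists_descendingEdge_starting_at (T := T) (p := 0) (c := Y.lo)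
    (by omega) (by omega)
  have be := descendingEdges_bounds he
  by_cases h₆ : Y.hi < e.top.2
  · obtain ⟨d, hd, h₇, h₈⟩ := h₅ _ h₂ h₆
    exact ⟨d, hd, h₇.symm, h₈⟩
  -- Dually, `[Y.lo, e.top.2]` is a subobject of `Y`; `e.top.2 ≤ Y.hi < n` makes it a ball.
  · exact (h ⟨Y.lo, e.top.2, h₁, by omega, by omega⟩
      ⟨e, he, rfl, by dsimp only; omega, h₄.ge⟩ ⟨le_rfl, by dsimp only; omega,
        by dsimp only; omega⟩).elim

/-! ### Morphisms between interval representations -/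

section Representations

variable {k : Type u} [Field k] {n : ℕ}

theorem QuiverRep.naturality_apply {V W : QuiverRep k n} (f : V ⟶ W) {i j : (QuiverVertex n)ᵒᵖ}
    (g : i ⟶ j) (v : V.obj i) :
    (f.app j).hom.hom ((V.map g).hom.hom v) = (W.map g).hom.hom ((f.app i).hom.hom v) :=
  congrArg (fun h : V.obj i ⟶ W.obj j => h.hom.hom v) (f.naturality g)

theorem QuiverRep.map_comp_apply (V : QuiverRep k n) {i j l : (QuiverVertex n)ᵒᵖ}
    (g : i ⟶ j) (h : j ⟶ l) (v : V.obj i) :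
    (V.map h).hom.hom ((V.map g).hom.hom v) = (V.map (g ≫ h)).hom.hom v :=
  congrArg (fun h : V.obj i ⟶ V.obj l => h.hom.hom v) (V.map_comp g h).symm

theorem QuiverRep.map_self_apply (V : QuiverRep k n) {i : (QuiverVertex n)ᵒᵖ}
    (g : i ⟶ i) (v : V.obj i) : (V.map g).hom.hom v = v := by
  rw [Subsingleton.elim g (𝟙 i)]
  exact congrArg (fun h : V.obj i ⟶ V.obj i => h.hom.hom v) (V.map_id i)

theorem QuiverRep.hom_ext {V W : QuiverRep k n} {f g : V ⟶ W}
    (h : ∀ i (v : V.obj i), (f.app i).hom.hom v = (g.app i).hom.hom v) : f = g :=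
  NatTrans.ext (funext fun i => FGModuleCat.hom_ext (LinearMap.ext (h i)))

/-- The coordinate of a vector in an interval representation. -/
noncomputable def Ball.coord (X : Ball n) (i : (QuiverVertex n)ᵒᵖ) : (X.rep k).obj i →ₗ[k] k :=
  (X.space k i.unop.1).subtype

theorem Ball.rep_ext (X : Ball n) {i : (QuiverVertex n)ᵒᵖ} {v w : (X.rep k).obj i}
    (h : X.lo ≤ i.unop.1 ∧ i.unop.1 ≤ X.hi → X.coord i v = X.coord i w) : v = w := by
  by_cases hi : X.lo ≤ i.unop.1 ∧ i.unop.1 ≤ X.hi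
  · exact Subtype.ext (h hi)
  · exact Subtype.ext ((X.space_eq_zero k hi v).trans (X.space_eq_zero k hi w).symm)

theorem Ball.rep_eq_zero (X : Ball n) {i : (QuiverVertex n)ᵒᵖ}
    (hi : ¬ (X.lo ≤ i.unop.1 ∧ i.unop.1 ≤ X.hi)) (v : (X.rep k).obj i) : v = 0 :=
  X.rep_ext fun h => (hi h).elim

theorem Ball.coord_map (X : Ball n) {i j : (QuiverVertex n)ᵒᵖ} (g : i ⟶ j)
    (hj : X.lo ≤ j.unop.1 ∧ j.unop.1 ≤ X.hi) (v : (X.rep k).obj i) :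
    X.coord j (((X.rep k).map g).hom.hom v) = X.coord i v :=
  X.transition_apply k hj v

theorem Ball.exists_coord_eq (X : Ball n) {i : (QuiverVertex n)ᵒᵖ}
    (hi : X.lo ≤ i.unop.1 ∧ i.unop.1 ≤ X.hi) (c : k) : ∃ v, X.coord i v = c :=
  ⟨(⟨c, by simp [Ball.space, hi]⟩ : X.space k i.unop.1), rfl⟩

/-- A morphism from an interval representation, given by a compatible family of vectors. -/
noncomputable def Ball.repHom (X : Ball n) {V : QuiverRep k n} (w : ∀ i, V.obj i)
    (hw : ∀ i : (QuiverVertex n)ᵒᵖ, i.unop.1 < X.lo → w i = 0)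
    (hw' : ∀ {i j : (QuiverVertex n)ᵒᵖ} (g : i ⟶ j), X.lo ≤ i.unop.1 → i.unop.1 ≤ X.hi →
      (V.map g).hom.hom (w i) = w j) : X.rep k ⟶ V where
  app i := FGModuleCat.ofHom ((LinearMap.toSpanSingleton k (V.obj i) (w i)).comp (X.coord i))
  naturality i j g := by
    refine FGModuleCat.hom_ext (LinearMap.ext fun c => ?_)
    change X.coord j (((X.rep k).map g).hom.hom c) • w j
      = (V.map g).hom.hom (X.coord i c • w i)
    have hij : j.unop.1 ≤ i.unop.1 := leOfHom g.unop
    by_cases hi : X.lo ≤ i.unop.1 ∧ i.unop.1 ≤ X.hi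
    · rw [map_smul, hw' g hi.1 hi.2]
      by_cases hj : X.lo ≤ j.unop.1
      · rw [X.coord_map g ⟨hj, hij.trans hi.2⟩]
      -- The arrow leaves the ball downwards, which forces `w j = 0`. Above `X.hi` no condition on
      -- `w` is needed, since the coordinate is zero there.
      · rw [hw j (not_le.mp hj), smul_zero, smul_zero]
    · rw [X.rep_eq_zero hi c]
      simp only [map_zero, zero_smul]

theorem Ball.repHom_app (X : Ball n) {V : QuiverRep k n} (w : ∀ i, V.obj i) (hw) (hw')
    (i : (QuiverVertex n)ᵒᵖ) (c : (X.rep k).obj i) :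
    ((X.repHom w hw hw').app i).hom.hom c = X.coord i c • w i :=
  rfl

/-- A functional, which vanishes at the vertices outside a ball, as a linear map to the space at
that vertex of the interval representation. -/
noncomputable def Ball.toRep (X : Ball n) {V : Type*} [AddCommGroup V] [Module k V]
    (i : (QuiverVertex n)ᵒᵖ) (φ : V →ₗ[k] k)
    (hφ : ¬ (X.lo ≤ i.unop.1 ∧ i.unop.1 ≤ X.hi) → φ = 0) : V →ₗ[k] (X.rep k).obj i :=
  LinearMap.codRestrict (X.space k i.unop.1) φ fun v => by
    by_cases hi : X.lo ≤ i.unop.1 ∧ i.unop.1 ≤ X.hi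
    · simp [Ball.space, hi]
    · rw [hφ hi]
      exact zero_mem _

/-- A morphism to an interval representation, given by a compatible family of functionals. -/
noncomputable def Ball.homRep (X : Ball n) {V : QuiverRep k n} (φ : ∀ i, V.obj i →ₗ[k] k)
    (hφ : ∀ i : (QuiverVertex n)ᵒᵖ, ¬ (X.lo ≤ i.unop.1 ∧ i.unop.1 ≤ X.hi) → φ i = 0)
    (hφ' : ∀ {i j : (QuiverVertex n)ᵒᵖ} (g : i ⟶ j), X.lo ≤ j.unop.1 → j.unop.1 ≤ X.hi →
      ∀ v, φ j ((V.map g).hom.hom v) = φ i v) : V ⟶ X.rep k where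
  app i := FGModuleCat.ofHom (X.toRep i (φ i) (hφ i))
  naturality i j g := by
    refine FGModuleCat.hom_ext (LinearMap.ext fun v => X.rep_ext fun hj => ?_)
    exact (hφ' g hj.1 hj.2 v).trans (X.coord_map g hj (X.toRep i (φ i) (hφ i) v)).symm

/-- The vertex of the quiver at the left end of a ball. -/
def Ball.loVertex (X : Ball n) : QuiverVertex n :=
  ⟨X.lo, X.one_le_lo, X.lo_le_hi.trans_lt X.hi_lt⟩

/-- The vertex of the quiver at the right end of a ball. -/
def Ball.hiVertex (X : Ball n) : QuiverVertex n :=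
  ⟨X.hi, Nat.lt_of_lt_of_le X.one_le_lo X.lo_le_hi, X.hi_lt⟩

/-- At a common vertex, if `Y.hi < X.hi` the vector comes from the vertex `X.hi`, where the target
is zero; if `Y.lo < X.lo` its image is detected at the vertex `Y.lo`, where the source is zero. -/
theorem Ball.hom_eq_zero {X Y : Ball n} (h : ¬ X.MapsTo Y) (f : X.rep k ⟶ Y.rep k) : f = 0 := by
  refine QuiverRep.hom_ext fun i v => Y.rep_ext fun hY => congrArg _ ?_
  change (f.app i).hom.hom v = 0
  by_cases hX : X.lo ≤ i.unop.1 ∧ i.unop.1 ≤ X.hi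
  swap
  · rw [X.rep_eq_zero hX v, map_zero]
  by_cases h₁ : X.lo ≤ Y.lo
  · have h₂ : ¬ X.hi ≤ Y.hi := fun h₂ => h ⟨h₁, hY.1.trans hX.2, h₂⟩
    have hi : i.unop ≤ X.hiVertex := hX.2
    let g : Opposite.op X.hiVertex ⟶ i := (homOfLE hi).op
    obtain ⟨v', hv'⟩ := X.exists_coord_eq (i := Opposite.op X.hiVertex) ⟨X.lo_le_hi, le_rfl⟩
      (X.coord i v)
    have hv : v = ((X.rep k).map g).hom.hom v' :=
      X.rep_ext fun _ => by rw [X.coord_map g hX, hv']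
    rw [hv, QuiverRep.naturality_apply f g v',
      Y.rep_eq_zero (fun h => h₂ h.2) ((f.app (Opposite.op X.hiVertex)).hom.hom v'), map_zero]
  · have hi : Y.loVertex ≤ i.unop := hY.1
    let g : i ⟶ Opposite.op Y.loVertex := (homOfLE hi).op
    refine Y.rep_ext fun _ => ?_
    rw [← Y.coord_map g ⟨le_rfl, Y.lo_le_hi⟩, ← QuiverRep.naturality_apply f g v,
      X.rep_eq_zero (fun h => h₁ h.1) (((X.rep k).map g).hom.hom v)]
    simp only [map_zero]

theorem Ball.exists_hom_ne_zero (k : Type u) [Field k] {X Y : Ball n} (h : X.MapsTo Y) :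
    ∃ f : X.rep k ⟶ Y.rep k, f ≠ 0 := by
  obtain ⟨h₁, h₂, h₃⟩ := h
  have hc (i : (QuiverVertex n)ᵒᵖ) : ∃ c : (Y.rep k).obj i,
      Y.lo ≤ i.unop.1 ∧ i.unop.1 ≤ Y.hi → Y.coord i c = 1 := by
    by_cases hi : Y.lo ≤ i.unop.1 ∧ i.unop.1 ≤ Y.hi
    · exact (Y.exists_coord_eq hi 1).imp fun c hc _ => hc
    · exact ⟨0, fun h => (hi h).elim⟩
  choose c hc using hc
  refine ⟨X.repHom (V := Y.rep k) c (fun i hi => Y.rep_eq_zero (by omega) _)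
    fun {i j} g hi hi' => Y.rep_ext fun hj => ?_, fun h => ?_⟩
  · have hij : j.unop.1 ≤ i.unop.1 := leOfHom g.unop
    rw [Y.coord_map g hj, hc j hj, hc i ⟨hj.1.trans hij, hi'.trans h₃⟩]
  · obtain ⟨v, hv⟩ := X.exists_coord_eq (k := k) (i := Opposite.op Y.loVertex) ⟨h₁, h₂⟩ 1
    have h₄ := congrArg (fun f : X.rep k ⟶ Y.rep k =>
      Y.coord _ ((f.app (Opposite.op Y.loVertex)).hom.hom v)) h
    rw [X.repHom_app, hv, one_smul, hc _ ⟨le_rfl, Y.lo_le_hi⟩] at h₄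
    exact one_ne_zero (h₄.trans (map_zero _))

theorem Ball.forall_hom_eq_zero_iff (k : Type u) [Field k] {X Y : Ball n} :
    (∀ f : X.rep k ⟶ Y.rep k, f = 0) ↔ ¬ X.MapsTo Y := by
  refine ⟨fun h h' => ?_, fun h f => Ball.hom_eq_zero h f⟩
  obtain ⟨f, hf⟩ := Ball.exists_hom_ne_zero k h'
  exact hf (h f)

theorem isBallTorsionPair_treeBalls (k : Type u) [Field k] {T : BinaryTree Unit}
    (hT : T.numLeaves = n + 1) :
    IsBallTorsionPair k (descendingBalls n T) (ascendingBalls n T) := by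
  simp only [IsBallTorsionPair, Ball.forall_hom_eq_zero_iff]
  exact ⟨mem_descendingBalls_iff hT, mem_ascendingBalls_iff hT⟩

end Representations

/-! ### Decomposition into interval representations -/

section Decomposition

variable {k : Type u} [Field k] {n : ℕ}

/-- Every nonzero representation has an interval representation as a retract. -/
theorem QuiverRep.exists_retract (V : QuiverRep k n) (hV : ∃ i, Nontrivial (V.obj i)) :
    ∃ (X : Ball n) (a : X.rep k ⟶ V) (b : V ⟶ X.rep k), a ≫ b = 𝟙 _ := by
  classical
  obtain ⟨s, hs⟩ := (Set.toFinite {i : QuiverVertex n | Nontrivial (V.obj (Opposite.op i))}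
    ).exists_maximal (hV.imp' Opposite.unop fun i hi => hi)
  have hs₁ : Nontrivial (V.obj (Opposite.op s)) := hs.1
  have hs₂ (i : QuiverVertex n) (hi : s < i) (v : V.obj (Opposite.op i)) : v = 0 := by
    by_contra h
    exact hi.not_ge (hs.2 ⟨v, 0, h⟩ hi.le)
  -- `w` is the trajectory of `v` along the arrows down from the top `s` of the support of `V`; `t`
  -- will be the last vertex where it survives.
  obtain ⟨v, hv⟩ := exists_ne (0 : V.obj (Opposite.op s))
  let w (i : (QuiverVertex n)ᵒᵖ) : V.obj i :=
    if hi : i.unop ≤ s then (V.map (homOfLE hi).op).hom.hom v else 0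
  have hw {i : (QuiverVertex n)ᵒᵖ} (hi : i.unop ≤ s) :
      w i = (V.map (homOfLE hi).op).hom.hom v := dif_pos hi
  have hws : w (Opposite.op s) = v := by
    rw [hw le_rfl]
    exact V.map_self_apply _ v
  have hwm {i j : (QuiverVertex n)ᵒᵖ} (g : i ⟶ j) (hi : i.unop ≤ s) :
      (V.map g).hom.hom (w i) = w j := by
    have hij : j.unop ≤ i.unop := leOfHom g.unop
    rw [hw hi, hw (hij.trans hi)]
    exact V.map_comp_apply _ _ v
  obtain ⟨t, ht⟩ := (Set.toFinite {i : QuiverVertex n | i ≤ s ∧ w (Opposite.op i) ≠ 0}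
    ).exists_minimal ⟨s, le_rfl, by rwa [hws]⟩
  have hts : t ≤ s := ht.1.1
  have ht₂ (i : QuiverVertex n) (hi : i < t) : w (Opposite.op i) = 0 := by
    by_contra h
    exact hi.not_ge (ht.2 ⟨hi.le.trans hts, h⟩ hi.le)
  obtain ⟨ψ, hψ⟩ : ∃ ψ : Module.Dual k (V.obj (Opposite.op t)), ψ (w (Opposite.op t)) = 1 :=
    Module.Projective.exists_dual_eq_one k ht.1.2
  let X : Ball n := ⟨t.1, s.1, t.2.1, hts, s.2.2⟩
  -- Pulling `ψ` back along the arrows into `t` gives compatible functionals with value 1 on the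
  -- trajectory, hence a retraction. Above `s` compatibility is free because `V` vanishes.
  let φ (i : (QuiverVertex n)ᵒᵖ) : V.obj i →ₗ[k] k :=
    if hi : t ≤ i.unop ∧ i.unop ≤ s then ψ.comp (V.map (homOfLE hi.1).op).hom.hom else 0
  have hφ {i : (QuiverVertex n)ᵒᵖ} (h₁ : t ≤ i.unop) (h₂ : i.unop ≤ s) (v : V.obj i) :
      φ i v = ψ ((V.map (homOfLE h₁).op).hom.hom v) := by
    simp only [φ, dif_pos (And.intro h₁ h₂)]
    rfl
  refine ⟨X, X.repHom w (fun i hi => ht₂ i.unop hi) fun {i j} g _ hi => hwm g hi,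
    X.homRep φ (fun i hi => dif_neg hi) fun {i j} g h₁ h₂ v => ?_,
    QuiverRep.hom_ext fun i c => X.rep_ext fun hi => ?_⟩
  · have hij : j.unop ≤ i.unop := leOfHom g.unop
    by_cases hi : i.unop ≤ s
    · rw [hφ h₁ h₂, hφ (le_trans h₁ hij) hi]
      exact congrArg ψ (V.map_comp_apply _ _ v)
    · have hv : v = 0 := hs₂ i.unop (not_le.mp hi) v
      rw [hv, map_zero, map_zero, map_zero]
  · change φ i (X.coord i c • w i) = X.coord i c
    rw [map_smul, hφ hi.1 hi.2, hwm _ hi.2]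
    exact (congrArg _ hψ).trans (mul_one _)

/-- A split summand isomorphic to an interval representation can be added to a direct sum
decomposition of its complement. -/
theorem ballClosure_of_kernel {S : Set (Ball n)} {V : QuiverRep k n} {X : Ball n} (hX : X ∈ S)
    {a : X.rep k ⟶ V} {b : V ⟶ X.rep k} (hab : a ≫ b = 𝟙 _)
    (hK : ballClosure k S (kernel b)) : ballClosure k S V := by
  obtain ⟨r, B, hB, ⟨e⟩⟩ := hK
  let B' : Fin (r + 1) → Ball n := Fin.cons X B
  have hB' (i : Fin (r + 1)) : B' i ∈ S := by
    refine Fin.cases ?_ (fun i => ?_) i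
    · exact hX
    · exact hB i
  -- As `b ≫ a` is idempotent, `𝟙 V - b ≫ a` projects onto the kernel of `b`, the complement of the
  -- summand `X`.
  let ρ : V ⟶ kernel b := kernel.lift b (𝟙 V - b ≫ a) (by simp [hab])
  have hρ : ρ ≫ kernel.ι b = 𝟙 V - b ≫ a := kernel.lift_ι _ _ _
  have hρ' : kernel.ι b ≫ ρ = 𝟙 _ := by
    rw [← cancel_mono (kernel.ι b), Category.assoc, hρ]
    simp
  have haρ : a ≫ ρ = 0 := by
    rw [← cancel_mono (kernel.ι b), Category.assoc, hρ]
    simp [reassoc_of% hab]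
  let p : ∀ i, V ⟶ (B' i).rep k :=
    Fin.cases b (fun i => ρ ≫ e.hom ≫ biproduct.π (fun i => (B i).rep k) i)
  let q : ∀ i, (B' i).rep k ⟶ V :=
    Fin.cases a (fun i => biproduct.ι (fun i => (B i).rep k) i ≫ e.inv ≫ kernel.ι b)
  let c : Bicone fun i => (B' i).rep k :=
    { pt := V
      π := p
      ι := q
      ι_π := fun i j => by
        refine Fin.cases ?_ (fun i => ?_) i <;> refine Fin.cases ?_ (fun j => ?_) j
        · rw [dif_pos rfl]
          exact hab
        · rw [dif_neg (Fin.succ_ne_zero j).symm]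
          change a ≫ ρ ≫ e.hom ≫ biproduct.π _ j = 0
          rw [reassoc_of% haρ, zero_comp]
        · rw [dif_neg (Fin.succ_ne_zero i)]
          change (biproduct.ι _ i ≫ e.inv ≫ kernel.ι b) ≫ b = 0
          simp
        · change (biproduct.ι (fun i => (B i).rep k) i ≫ e.inv ≫ kernel.ι b) ≫
            ρ ≫ e.hom ≫ biproduct.π (fun i => (B i).rep k) j = _
          simp only [Category.assoc, reassoc_of% hρ', Iso.inv_hom_id_assoc]
          by_cases hij : i = j
          · subst hij
            simp
            rfl
          · rw [biproduct.ι_π_ne _ hij, dif_neg (fun h => hij (Fin.succ_injective _ h))]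
            rfl }
  have hc : ∑ i, c.π i ≫ c.ι i = 𝟙 c.pt := by
    rw [Fin.sum_univ_succ]
    change b ≫ a + ∑ i : Fin r, (ρ ≫ e.hom ≫ biproduct.π (fun i => (B i).rep k) i) ≫
      biproduct.ι (fun i => (B i).rep k) i ≫ e.inv ≫ kernel.ι b = 𝟙 V
    have h (i : Fin r) : (ρ ≫ e.hom ≫ biproduct.π (fun i => (B i).rep k) i) ≫
        biproduct.ι (fun i => (B i).rep k) i ≫ e.inv ≫ kernel.ι b =
        (ρ ≫ e.hom) ≫ (biproduct.π (fun i => (B i).rep k) i ≫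
          biproduct.ι (fun i => (B i).rep k) i) ≫ e.inv ≫ kernel.ι b := by
      simp only [Category.assoc]
    rw [Finset.sum_congr rfl fun i _ => h i, ← Preadditive.comp_sum, ← Preadditive.sum_comp,
      biproduct.total]
    simp [hρ]
  exact ⟨r + 1, B', hB', ⟨biproduct.uniqueUpToIso _ (isBilimitOfTotal c hc)⟩⟩

theorem QuiverRep.app_injective {V W : QuiverRep k n} (f : V ⟶ W) [Mono f]
    (i : (QuiverVertex n)ᵒᵖ) : Function.Injective (f.app i).hom.hom :=
  (ModuleCat.mono_iff_injective _).mp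
    (inferInstanceAs (Mono ((forget₂ (FGModuleCat k) (ModuleCat k)).map (f.app i))))

/-- The sum of the dimensions of a representation at all vertices. -/
noncomputable def QuiverRep.totalDim (V : QuiverRep k n) : ℕ :=
  ∑ i : QuiverVertex n, Module.finrank k (V.obj (Opposite.op i))

theorem QuiverRep.totalDim_kernel_lt {V : QuiverRep k n} {X : Ball n} {a : X.rep k ⟶ V}
    {b : V ⟶ X.rep k} (hab : a ≫ b = 𝟙 _) : QuiverRep.totalDim (kernel b) < V.totalDim := by
  refine Finset.sum_lt_sum (fun i _ => LinearMap.finrank_le_finrank_of_injective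
    (QuiverRep.app_injective (kernel.ι b) (Opposite.op i))) ⟨X.hiVertex, Finset.mem_univ _, ?_⟩
  set i : (QuiverVertex n)ᵒᵖ := Opposite.op X.hiVertex
  have hι := QuiverRep.app_injective (kernel.ι b) i
  rw [← LinearMap.finrank_range_of_inj hι]
  -- The inclusion of the kernel is not onto at the vertex `X.hi`: `b` sends the image under `a` of
  -- a nonzero vector back to that vector.
  refine Submodule.finrank_lt fun h => ?_
  obtain ⟨c, hc⟩ := X.exists_coord_eq (k := k) (i := i) ⟨X.lo_le_hi, le_rfl⟩ 1
  obtain ⟨v, hv⟩ : (a.app i).hom.hom c ∈ LinearMap.range ((kernel.ι b).app i).hom.hom :=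
    h ▸ Submodule.mem_top
  have h₁ : (b.app i).hom.hom ((a.app i).hom.hom c) = c :=
    congrArg (fun f : X.rep k ⟶ X.rep k => (f.app i).hom.hom c) hab
  have h₂ : (b.app i).hom.hom (((kernel.ι b).app i).hom.hom v) = 0 :=
    congrArg (fun f : kernel b ⟶ X.rep k => (f.app i).hom.hom v) (kernel.condition b)
  rw [hv, h₁] at h₂
  rw [h₂, map_zero] at hc
  exact zero_ne_one hc

/-- Every representation is a finite direct sum of interval representations. -/
theorem ballClosure_univ (V : QuiverRep k n) : ballClosure k Set.univ V := by
  induction h : V.totalDim using Nat.strong_induction_on generalizing V with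
  | _ d ih =>
    by_cases hV : ∃ i, Nontrivial (V.obj i)
    · obtain ⟨X, a, b, hab⟩ := V.exists_retract hV
      exact ballClosure_of_kernel (Set.mem_univ X) hab
        (ih _ (h ▸ QuiverRep.totalDim_kernel_lt hab) _ rfl)
    · have h₀ : IsZero V := by
        rw [IsZero.iff_id_eq_zero]
        refine QuiverRep.hom_ext fun i v => ?_
        by_contra hv
        exact hV ⟨i, _, _, hv⟩
      exact ⟨0, Fin.elim0, fun i => i.elim0, ⟨h₀.iso (by
        rw [IsZero.iff_id_eq_zero]
        exact biproduct.hom_ext _ _ fun i => i.elim0)⟩⟩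

theorem ballClosure_rep {S : Set (Ball n)} {X : Ball n} (hX : X ∈ S) :
    ballClosure k S (X.rep k) :=
  ⟨1, fun _ => X, fun _ => hX, ⟨(biproductUniqueIso fun _ : Fin 1 => X.rep k).symm⟩⟩

theorem hom_eq_zero_of_ballClosure {S S' : Set (Ball n)}
    (h : ∀ X ∈ S, ∀ Y ∈ S', ∀ f : X.rep k ⟶ Y.rep k, f = 0) {V W : QuiverRep k n}
    (hV : ballClosure k S V) (hW : ballClosure k S' W) (f : V ⟶ W) : f = 0 := by
  obtain ⟨r, B, hB, ⟨e⟩⟩ := hV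
  obtain ⟨r', B', hB', ⟨e'⟩⟩ := hW
  have h₀ : e.inv ≫ f ≫ e'.hom = 0 :=
    biproduct.hom_ext' _ _ fun i => biproduct.hom_ext _ _ fun j => by
      rw [comp_zero, zero_comp]
      exact h _ (hB i) _ (hB' j) _
  simpa using congrArg (fun g => e.hom ≫ g ≫ e'.inv) h₀

/-- A torsion pair of sets of balls spans a torsion pair of representations. -/
theorem IsBallTorsionPair.isTorsionPair {S S' : Set (Ball n)} (h : IsBallTorsionPair k S S') :
    IsTorsionPair (ballClosure k S) (ballClosure k S') := by
  have h₀ : ∀ X ∈ S, ∀ Y ∈ S', ∀ f : X.rep k ⟶ Y.rep k, f = 0 := fun X hX => (h.1 X).mp hX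
  refine ⟨fun V => ⟨fun hV W hW => hom_eq_zero_of_ballClosure h₀ hV hW, fun hV => ?_⟩,
    fun W => ⟨fun hW V hV => hom_eq_zero_of_ballClosure h₀ hV hW, fun hW => ?_⟩⟩
  · obtain ⟨r, B, -, ⟨e⟩⟩ := ballClosure_univ V
    refine ⟨r, B, fun i => (h.1 _).mpr fun Y hY f => ?_, ⟨e⟩⟩
    -- A map out of one summand extends by the projection to a map out of `V`, so each summand
    -- inherits the orthogonality.
    have h₁ := hV _ (ballClosure_rep hY) (e.hom ≫ biproduct.π _ i ≫ f)
    simpa using congrArg (fun g => biproduct.ι (fun i => (B i).rep k) i ≫ e.inv ≫ g) h₁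
  · obtain ⟨r, B, -, ⟨e⟩⟩ := ballClosure_univ W
    refine ⟨r, B, fun i => (h.2 _).mpr fun X hX f => ?_, ⟨e⟩⟩
    have h₁ := hW _ (ballClosure_rep hX) (f ≫ biproduct.ι (fun i => (B i).rep k) i ≫ e.inv)
    simpa using congrArg (fun g => g ≫ e.hom ≫ biproduct.π (fun i => (B i).rep k) i) h₁

end Decomposition

theorem mainTheorem2 (k : Type u) [Field k] (n : ℕ) (T : BinaryTree Unit)
    (hT : T.numLeaves = n + 1) :
    IsBallTorsionPair k (descendingBalls n T) (ascendingBalls n T) ∧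
      IsTorsionPair (ballClosure k (descendingBalls n T))
        (ballClosure k (ascendingBalls n T)) :=
  ⟨isBallTorsionPair_treeBalls k hT, (isBallTorsionPair_treeBalls k hT).isTorsionPair⟩
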